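/- For complex $x,q$ with $|q|<1$ let $(x;q)_\infty=\prod_{k\ge 0}(1-xq^k)$ and $(x,y;q)_\infty=(x;q)_\infty(y;q)_\infty$. Let $a,b,q\in\mathbb C$ with $|q|<1$, $a\neq 0$, $|qb/a|<1$, and suppose that $(a^2q,b^2q;q^4)_\infty$ and $(a^2q^3,b^2q^3;q^4)_\infty$ are not both $0$. Then the continued fraction $$\frac{\alpha_1}{\beta_1}{\genfrac{}{}{0pt}{}{}{+}}\frac{\alpha_2}{\beta_2}{\genfrac{}{}{0pt}{}{}{+}}\frac{\alpha_3}{\beta_3}{\genfrac{}{}{0pt}{}{}{+\cdots}} =\frac{(1-a^2q)(1-b^2q)}{1-abq^2}{\genfrac{}{}{0pt}{}{}{+}}\frac{(a-bq)(b-aq)q^2}{1-abq^4}{\genfrac{}{}{0pt}{}{}{+}}\frac{(1-a^2q^3)(1-b^2q^3)q^2}{1-abq^6}{\genfrac{}{}{0pt}{}{}{+}}\frac{(a-bq^3)(b-aq^3)q^4}{1-abq^8}{\genfrac{}{}{0pt}{}{}{+\cdots}}$$ with, for $n\ge1$, $\beta_n=1-abq^{2n}$, $\alpha_n=(1-a^2q^n)(1-b^2q^n)q^{n-1}$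 for odd $n$ and $\alpha_n=(a-bq^{n-1})(b-aq^{n-1})q^n$ for even $n$, converges in $\hat{\mathbb C}=\mathbb C\cup\{\infty\}$, and its value is $$\frac{(a^2q,b^2q;q^4)_\infty}{(a^2q^3,b^2q^3;q^4)_\infty}$$ (which is $\infty$ if the denominator vanishes). Here convergence means that the approximants $s_1\circ\cdots\circ s_n(0)$, $s_i(w)=\alpha_i/(\beta_i+w)$, computed in $\hat{\mathbb C}$, tend to that value; if some $\alpha_i=0$, then $s_i$ is read as the constant $0$, i.e. the continued fraction terminates before its first vanishing partial numerator. -/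

import Mathlib

open Filter Topology

noncomputable section

/-- The infinite `q`-shifted factorial `(x; q)_∞ = ∏_{k ≥ 0} (1 - x q ^ k)`. -/
def qPochInf (x q : ℂ) : ℂ := ∏' k : ℕ, (1 - x * q ^ k)

/-- For `|q| < 1` the product defining `(x; q)_∞` converges. -/
theorem qPochInf_multipliable (x : ℂ) {q : ℂ} (hq : ‖q‖ < 1) :
    Multipliable fun k : ℕ => 1 - x * q ^ k := by
  have h : Summable fun k : ℕ => ‖-(x * q ^ k)‖ := by
    simp only [norm_neg, norm_mul, norm_pow]
    exact (summable_geometric_of_lt_one (norm_nonneg q) hq).mul_left _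
  simpa only [sub_eq_add_neg] using multipliable_one_add_of_summable h

/-- The value `p / r` in the Riemann sphere `ℂ ∪ {∞}`, for `(p, r) ≠ (0, 0)`. -/
def sphereDiv (p r : ℂ) : OnePoint ℂ :=
  open Classical in if r = 0 then OnePoint.infty else ((p / r : ℂ) : OnePoint ℂ)

/-- The map `w ↦ α / (β + w)` of the Riemann sphere. For `α = 0` it is constantly `0`: a
continued fraction terminates before its first vanishing partial numerator. -/
def cfStep (α β : ℂ) : OnePoint ℂ → OnePoint ℂ
  | OnePoint.infty => ((0 : ℂ) : OnePoint ℂ)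
  | OnePoint.some w =>
    open Classical in if α = 0 then ((0 : ℂ) : OnePoint ℂ) else sphereDiv α (β + w)

/-- The composition `S_n = s_1 ∘ s_2 ∘ ⋯ ∘ s_n`, where `s_i (w) = α_i / (β_i + w)`. The values of
`α` and `β` at `0` are not used. -/
def cfComp (α β : ℕ → ℂ) : ℕ → OnePoint ℂ → OnePoint ℂ
  | 0, w => w
  | n + 1, w => cfComp α β n (cfStep (α (n + 1)) (β (n + 1)) w)

/-- The `n`-th approximant `α_1 / (β_1 + α_2 / (β_2 + ⋯ + α_n / β_n))`, in the Riemann sphere. -/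
def cfApproximant (α β : ℕ → ℂ) (n : ℕ) : OnePoint ℂ := cfComp α β n ((0 : ℂ) : OnePoint ℂ)

/-- The continued fraction `K_{n ≥ 1} (α_n / β_n)` converges to `f` in the Riemann sphere. -/
def CFConvergesTo (α β : ℕ → ℂ) (f : OnePoint ℂ) : Prop :=
  Tendsto (cfApproximant α β) atTop (𝓝 f)

/-- The partial numerators, `n ≥ 1`: `(1 - a²qⁿ)(1 - b²qⁿ)qⁿ⁻¹` for odd `n`,
`(a - bqⁿ⁻¹)(b - aqⁿ⁻¹)qⁿ` for even `n`. -/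
def productCFNum (a b q : ℂ) (n : ℕ) : ℂ :=
  if Odd n then (1 - a ^ 2 * q ^ n) * (1 - b ^ 2 * q ^ n) * q ^ (n - 1)
  else (a - b * q ^ (n - 1)) * (b - a * q ^ (n - 1)) * q ^ n

/-- The partial denominators, `n ≥ 1`. -/
def productCFDen (a b q : ℂ) (n : ℕ) : ℂ := 1 - a * b * q ^ (2 * n)

/-- `(a²q, b²q; q⁴)_∞`. -/
def productNum (a b q : ℂ) : ℂ := qPochInf (a ^ 2 * q) (q ^ 4) * qPochInf (b ^ 2 * q) (q ^ 4)

/-- `(a²q³, b²q³; q⁴)_∞`. -/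
def productDen (a b q : ℂ) : ℂ :=
  qPochInf (a ^ 2 * q ^ 3) (q ^ 4) * qPochInf (b ^ 2 * q ^ 3) (q ^ 4)

end

/-! Canonical numerators and denominators solve one three-term recurrence. Its coefficients α and β
- 1 are geometrically small, so every solution converges (`tendsto_cfRec`). Write Λ(a,b;x,y) for the
limit from initial values x, y. A Bauer–Muir transformation gives Λ(a,b;x,y) = Λ(aq,bq;y,α₁x). Hence
Λ(a,b;0,1) = Λ(aq,bq;1,0) and Λ(a,b;1,0) = α₁Λ(aq²,bq²;1,0). Iterating the latter
(`productCFLim_eq_mul_productNum`), with Λ continuous in its parameters, makes both limits the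
claimed products times the same constant Λ(0,0;1,0) = ∏(1 + q^(2j+2)) ≠ 0, which cancels in the
quotient. -/

/-- The solution of the three-term recurrence `X (n + 2) = β (n + 1) X (n + 1) + α (n + 1) X n`
with initial values `x, y`. For `(x, y) = (1, 0)` and `(0, 1)` its value at `n + 1` is the `n`-th
canonical numerator and denominator of the continued fraction `K (α n / β n)`. -/
def cfRec (α β : ℕ → ℂ) (x y : ℂ) : ℕ → ℂ
  | 0 => x
  | 1 => y
  | n + 2 => β (n + 1) * cfRec α β x y (n + 1) + α (n + 1) * cfRec α β x y n

theorem cfRec_add_two (α β : ℕ → ℂ) (x y : ℂ) (n : ℕ) :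
    cfRec α β x y (n + 2) = β (n + 1) * cfRec α β x y (n + 1) + α (n + 1) * cfRec α β x y n := rfl

theorem cfRec_smul (α β : ℕ → ℂ) (c x y : ℂ) (n : ℕ) :
    cfRec α β (c * x) (c * y) n = c * cfRec α β x y n := by
  induction n using Nat.twoStepInduction with
  | zero => rfl
  | one => rfl
  | more n h₁ h₂ => rw [cfRec_add_two, cfRec_add_two, h₁, h₂]; ring

/-! ### Approximants as quotients of canonical numerators and denominators -/

theorem sphereDiv_mul_left {c : ℂ} (hc : c ≠ 0) (p r : ℂ) :
    sphereDiv (c * p) (c * r) = sphereDiv p r := by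
  unfold sphereDiv
  by_cases hr : r = 0
  · simp [hr]
  · simp [hr, hc, mul_div_mul_left]

theorem sphereDiv_eq_of_mul_eq {p r p' r' : ℂ} (h : p ≠ 0 ∨ r ≠ 0) (h' : p' ≠ 0 ∨ r' ≠ 0)
    (heq : p * r' = p' * r) : sphereDiv p r = sphereDiv p' r' := by
  unfold sphereDiv
  by_cases hr : r = 0
  · have hp : p ≠ 0 := h.resolve_right (not_not.2 hr)
    have hr' : r' = 0 := by simpa [hr, hp] using heq
    simp [hr, hr']
  · have hr' : r' ≠ 0 := by
      intro h0
      have : p' = 0 := by simpa [hr, h0] using heq.symm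
      exact h'.elim (· this) (· h0)
    rw [if_neg hr, if_neg hr', (div_eq_div_iff hr hr').2 heq]

theorem sphereDiv_one_right (w : ℂ) : sphereDiv w 1 = (w : OnePoint ℂ) := by
  simp [sphereDiv]

theorem tendsto_sphereDiv {ι : Type*} {l : Filter ι} {f g : ι → ℂ} {p r : ℂ}
    (hf : Tendsto f l (𝓝 p)) (hg : Tendsto g l (𝓝 r)) (h : p ≠ 0 ∨ r ≠ 0) :
    Tendsto (fun i => sphereDiv (f i) (g i)) l (𝓝 (sphereDiv p r)) := by
  by_cases hr : r = 0
  · have hp : p ≠ 0 := h.resolve_right (not_not.2 hr)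
    have hlim : sphereDiv p r = OnePoint.infty := by simp [sphereDiv, hr]
    rw [hlim, OnePoint.hasBasis_nhds_infty.tendsto_right_iff]
    rintro s ⟨-, hs⟩
    -- Neighbourhoods of ∞ are complements of compact sets, so it suffices that the quotient
    -- eventually exceeds every radius R.
    obtain ⟨R, hR⟩ := hs.isBounded.exists_norm_le
    have hlt : ∀ᶠ i in l, R * ‖g i‖ < ‖f i‖ := by
      have h₁ : Tendsto (fun i => R * ‖g i‖) l (𝓝 0) := by
        simpa [hr] using hg.norm.const_mul R
      exact h₁.eventually_lt hf.norm (norm_pos_iff.2 hp)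
    filter_upwards [hlt] with i hi
    unfold sphereDiv
    by_cases h0 : g i = 0
    · simp [h0]
    · rw [if_neg h0]
      refine Or.inl ⟨f i / g i, fun hmem => ?_, rfl⟩
      have := hR _ hmem
      rw [norm_div, div_le_iff₀ (norm_pos_iff.2 h0)] at this
      linarith
  · have hlim : sphereDiv p r = ((p / r : ℂ) : OnePoint ℂ) := by simp [sphereDiv, hr]
    rw [hlim]
    have h₁ : Tendsto (fun i => ((f i / g i : ℂ) : OnePoint ℂ)) l (𝓝 ((p / r : ℂ) : OnePoint ℂ)) :=
      (OnePoint.continuous_coe.tendsto _).comp (hf.div hg hr)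
    refine h₁.congr' ?_
    filter_upwards [hg.eventually_ne hr] with i hi
    simp [sphereDiv, hi]

theorem cfComp_eq_sphereDiv {α β : ℕ → ℂ} (n : ℕ) (hα : ∀ i < n, α (i + 1) ≠ 0) :
    cfComp α β n OnePoint.infty = sphereDiv (cfRec α β 1 0 n) (cfRec α β 0 1 n) ∧
    ∀ w : ℂ, cfComp α β n (w : OnePoint ℂ) =
      sphereDiv (cfRec α β 1 0 (n + 1) + w * cfRec α β 1 0 n)
        (cfRec α β 0 1 (n + 1) + w * cfRec α β 0 1 n) := by
  induction n with
  | zero =>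
    refine ⟨?_, fun w => ?_⟩
    · simp [cfComp, cfRec, sphereDiv]
    · simp [cfComp, cfRec, sphereDiv_one_right]
  | succ n ih =>
    obtain ⟨hinf, hfin⟩ := ih fun i hi => hα i (hi.trans n.lt_succ_self)
    have hn : α (n + 1) ≠ 0 := hα n n.lt_succ_self
    refine ⟨?_, fun w => ?_⟩
    · change cfComp α β n ((0 : ℂ) : OnePoint ℂ) = _
      rw [hfin]
      simp
    · have hstep : cfStep (α (n + 1)) (β (n + 1)) (w : OnePoint ℂ) =
          sphereDiv (α (n + 1)) (β (n + 1) + w) := if_neg hn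
      change cfComp α β n (cfStep (α (n + 1)) (β (n + 1)) (w : OnePoint ℂ)) = _
      rw [hstep, cfRec_add_two, cfRec_add_two]
      -- At the pole of the innermost step the other half of the induction hypothesis, the value at
      -- ∞, is needed.
      by_cases h0 : β (n + 1) + w = 0
      · have hw : w = -β (n + 1) := by linear_combination h0
        have : sphereDiv (α (n + 1)) (β (n + 1) + w) = OnePoint.infty := by simp [sphereDiv, h0]
        rw [this, hinf, ← sphereDiv_mul_left hn, hw]
        congr 1 <;> ring
      · have : sphereDiv (α (n + 1)) (β (n + 1) + w) =
            ((α (n + 1) / (β (n + 1) + w) : ℂ) : OnePoint ℂ) := by simp [sphereDiv, h0]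
        rw [this, hfin, ← sphereDiv_mul_left h0]
        congr 1 <;> field_simp <;> ring

theorem cfApproximant_eq_sphereDiv {α β : ℕ → ℂ} (n : ℕ) (hα : ∀ i < n, α (i + 1) ≠ 0) :
    cfApproximant α β n = sphereDiv (cfRec α β 1 0 (n + 1)) (cfRec α β 0 1 (n + 1)) := by
  rw [cfApproximant, (cfComp_eq_sphereDiv n hα).2]
  simp

theorem cfApproximant_eq_of_num_eq_zero {α β : ℕ → ℂ} {m n : ℕ} (hm : α (m + 1) = 0)
    (hn : m ≤ n) : cfApproximant α β n = cfApproximant α β m := by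
  have h : ∀ k w, cfComp α β (m + 1 + k) w = cfApproximant α β m := by
    intro k
    induction k with
    | zero =>
      intro w
      change cfComp α β m (cfStep (α (m + 1)) (β (m + 1)) w) = _
      have : cfStep (α (m + 1)) (β (m + 1)) w = ((0 : ℂ) : OnePoint ℂ) := by
        cases w with
        | infty => rfl
        | coe w => exact if_pos hm
      rw [this, cfApproximant]
    | succ k ih => exact fun w => ih _
  rcases hn.eq_or_lt with rfl | hlt
  · rfl
  · obtain ⟨k, rfl⟩ := Nat.exists_eq_add_of_le hlt
    exact h k _

/-- The determinant of the two solutions is, up to sign, the product of the partial numerators. -/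
theorem cfRec_pair_ne_zero {α β : ℕ → ℂ} (n : ℕ) (hα : ∀ i < n, α (i + 1) ≠ 0) :
    cfRec α β 1 0 (n + 1) ≠ 0 ∨ cfRec α β 0 1 (n + 1) ≠ 0 := by
  have hdet : cfRec α β 1 0 (n + 1) * cfRec α β 0 1 n - cfRec α β 1 0 n * cfRec α β 0 1 (n + 1)
      ≠ 0 := by
    induction n with
    | zero => simp [cfRec]
    | succ n ih =>
      have hprod := mul_ne_zero (neg_ne_zero.2 (hα n n.lt_succ_self))
        (ih fun i hi => hα i (hi.trans n.lt_succ_self))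
      rw [cfRec_add_two, cfRec_add_two]
      intro h0
      exact hprod (by linear_combination h0)
  by_contra! h
  exact hdet (by rw [h.1, h.2]; ring)

/-- Once a numerator vanishes, the next value is a multiple of the current one, so both solutions
continue with a common factor. Thus the limiting ratio is also the value of the terminated fraction.
-/
theorem cfRec_mul_eq_of_num_eq_zero {α β : ℕ → ℂ} {m : ℕ} (hm : α (m + 1) = 0) (k : ℕ) :
    cfRec α β 1 0 (m + 1) * cfRec α β 0 1 (m + 1 + k) =
      cfRec α β 1 0 (m + 1 + k) * cfRec α β 0 1 (m + 1) := by
  induction k using Nat.twoStepInduction with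
  | zero => rfl
  | one =>
    change _ * cfRec α β 0 1 (m + 2) = cfRec α β 1 0 (m + 2) * _
    rw [cfRec_add_two, cfRec_add_two, hm]
    ring
  | more k h₁ h₂ =>
    change _ * cfRec α β 0 1 (m + 1 + k + 2) = cfRec α β 1 0 (m + 1 + k + 2) * _
    change _ * cfRec α β 0 1 (m + 1 + k + 1) = cfRec α β 1 0 (m + 1 + k + 1) * _ at h₂
    rw [cfRec_add_two, cfRec_add_two]
    linear_combination α (m + 1 + k + 1) * h₁ + β (m + 1 + k + 1) * h₂

theorem cfConvergesTo_sphereDiv {α β : ℕ → ℂ} {p r : ℂ}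
    (hp : Tendsto (cfRec α β 1 0) atTop (𝓝 p)) (hr : Tendsto (cfRec α β 0 1) atTop (𝓝 r))
    (h : p ≠ 0 ∨ r ≠ 0) : CFConvergesTo α β (sphereDiv p r) := by
  classical
  by_cases hα : ∃ m, α (m + 1) = 0
  · have hm := Nat.find_spec hα
    have hlt : ∀ i < Nat.find hα, α (i + 1) ≠ 0 := fun i hi => Nat.find_min hα hi
    set m := Nat.find hα
    have heq : cfRec α β 1 0 (m + 1) * r = p * cfRec α β 0 1 (m + 1) := by
      have hshift : Tendsto (fun k => m + 1 + k) atTop atTop :=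
        tendsto_atTop_mono (fun k => Nat.le_add_left k (m + 1)) tendsto_id
      refine tendsto_nhds_unique ((hr.comp hshift).const_mul _) ?_
      refine ((hp.comp hshift).mul_const _).congr fun k => ?_
      exact (cfRec_mul_eq_of_num_eq_zero hm k).symm
    rw [← sphereDiv_eq_of_mul_eq (cfRec_pair_ne_zero m hlt) h heq,
      ← cfApproximant_eq_sphereDiv m hlt]
    refine tendsto_const_nhds.congr' ?_
    filter_upwards [eventually_ge_atTop m] with n hn
    exact (cfApproximant_eq_of_num_eq_zero hm hn).symm
  · push Not at hα
    refine (tendsto_sphereDiv (hp.comp (tendsto_add_atTop_nat 1))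
      (hr.comp (tendsto_add_atTop_nat 1)) h).congr fun n => ?_
    exact (cfApproximant_eq_sphereDiv n fun i _ => hα i).symm

/-! ### Convergence of solutions of the recurrence -/

/-- A discrete Grönwall bound: each step enlarges the maximum of two consecutive norms by at most
the factor 1 + ε n. -/
theorem norm_cfRec_le {α β : ℕ → ℂ} {ε : ℕ → ℝ} (hε : Summable ε)
    (h : ∀ n, ‖β (n + 1) - 1‖ + ‖α (n + 1)‖ ≤ ε n) (x y : ℂ) (n : ℕ) :
    ‖cfRec α β x y n‖ ≤ (‖x‖ + ‖y‖) * Real.exp (∑' n, ε n) := by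
  have hε0 : ∀ n, 0 ≤ ε n := fun n => le_trans (by positivity) (h n)
  have key : ∀ n, ‖cfRec α β x y n‖ ≤ (‖x‖ + ‖y‖) * ∏ i ∈ Finset.range n, (1 + ε i) ∧
      ‖cfRec α β x y (n + 1)‖ ≤ (‖x‖ + ‖y‖) * ∏ i ∈ Finset.range n, (1 + ε i) := by
    intro n
    induction n with
    | zero => simp [cfRec]
    | succ n ih =>
      set P := (‖x‖ + ‖y‖) * ∏ i ∈ Finset.range n, (1 + ε i)
      have hP : 0 ≤ P := (norm_nonneg _).trans ih.1
      have hprod : (‖x‖ + ‖y‖) * ∏ i ∈ Finset.range (n + 1), (1 + ε i) = P * (1 + ε n) := by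
        rw [Finset.prod_range_succ, mul_assoc]
      rw [hprod]
      refine ⟨ih.2.trans (le_mul_of_one_le_right hP (by linarith [hε0 n])), ?_⟩
      rw [cfRec_add_two]
      calc _ = ‖cfRec α β x y (n + 1) + ((β (n + 1) - 1) * cfRec α β x y (n + 1) +
              α (n + 1) * cfRec α β x y n)‖ := by congr 1; ring
        _ ≤ ‖cfRec α β x y (n + 1)‖ + (‖β (n + 1) - 1‖ * ‖cfRec α β x y (n + 1)‖ +
              ‖α (n + 1)‖ * ‖cfRec α β x y n‖) := by
            refine (norm_add_le _ _).trans (add_le_add le_rfl ((norm_add_le _ _).trans ?_))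
            rw [norm_mul, norm_mul]
        _ ≤ P + (‖β (n + 1) - 1‖ * P + ‖α (n + 1)‖ * P) := by
            gcongr
            exacts [ih.2, ih.2, ih.1]
        _ = P * (1 + (‖β (n + 1) - 1‖ + ‖α (n + 1)‖)) := by ring
        _ ≤ P * (1 + ε n) := by gcongr; exact h n
  refine (key n).1.trans (mul_le_mul_of_nonneg_left ?_ (by positivity))
  exact (Real.prod_one_add_le_exp_sum _ hε0).trans
    (Real.exp_le_exp.2 (hε.sum_le_tsum _ fun i _ => hε0 i))

theorem norm_cfRec_sub_le {α β : ℕ → ℂ} {ε : ℕ → ℝ} (hε : Summable ε)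
    (h : ∀ n, ‖β (n + 1) - 1‖ + ‖α (n + 1)‖ ≤ ε n) (x y : ℂ) (n : ℕ) :
    ‖cfRec α β x y (n + 2) - cfRec α β x y (n + 1)‖ ≤
      ε n * ((‖x‖ + ‖y‖) * Real.exp (∑' n, ε n)) := by
  set C := (‖x‖ + ‖y‖) * Real.exp (∑' n, ε n)
  have hC : 0 ≤ C := by positivity
  rw [cfRec_add_two]
  calc _ = ‖(β (n + 1) - 1) * cfRec α β x y (n + 1) + α (n + 1) * cfRec α β x y n‖ := by
        congr 1; ring
    _ ≤ ‖β (n + 1) - 1‖ * C + ‖α (n + 1)‖ * C := by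
        refine (norm_add_le _ _).trans ?_
        rw [norm_mul, norm_mul]
        gcongr <;> exact norm_cfRec_le hε h x y _
    _ = (‖β (n + 1) - 1‖ + ‖α (n + 1)‖) * C := by ring
    _ ≤ ε n * C := by gcongr; exact h n

/-- The limit of the solution of the recurrence, when it converges. -/
noncomputable def cfRecLim (α β : ℕ → ℂ) (x y : ℂ) : ℂ :=
  y + ∑' n, (cfRec α β x y (n + 2) - cfRec α β x y (n + 1))

theorem tendsto_cfRec {α β : ℕ → ℂ} {ε : ℕ → ℝ} (hε : Summable ε)
    (h : ∀ n, ‖β (n + 1) - 1‖ + ‖α (n + 1)‖ ≤ ε n) (x y : ℂ) :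
    Tendsto (cfRec α β x y) atTop (𝓝 (cfRecLim α β x y)) := by
  rw [← tendsto_add_atTop_iff_nat 1]
  have hs : Summable fun n => cfRec α β x y (n + 2) - cfRec α β x y (n + 1) :=
    (hε.mul_right _).of_norm_bounded (norm_cfRec_sub_le hε h x y)
  refine (hs.hasSum.tendsto_sum_nat.const_add y).congr fun n => ?_
  rw [Finset.sum_range_sub fun n => cfRec α β x y (n + 1)]
  simp [cfRec]

/-- Continuous dependence of the limit on the coefficients. -/
theorem tendsto_cfRecLim {α β : ℕ → ℕ → ℂ} {α' β' : ℕ → ℂ} {ε : ℕ → ℝ} (hε : Summable ε)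
    (h : ∀ k n, ‖β k (n + 1) - 1‖ + ‖α k (n + 1)‖ ≤ ε n)
    (hα : ∀ n, Tendsto (fun k => α k n) atTop (𝓝 (α' n)))
    (hβ : ∀ n, Tendsto (fun k => β k n) atTop (𝓝 (β' n))) (x y : ℂ) :
    Tendsto (fun k => cfRecLim (α k) (β k) x y) atTop (𝓝 (cfRecLim α' β' x y)) := by
  have hrec : ∀ n, Tendsto (fun k => cfRec (α k) (β k) x y n) atTop (𝓝 (cfRec α' β' x y n)) := by
    intro n
    induction n using Nat.twoStepInduction with
    | zero => exact tendsto_const_nhds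
    | one => exact tendsto_const_nhds
    | more n h₁ h₂ => exact ((hβ _).mul h₂).add ((hα _).mul h₁)
  refine Tendsto.const_add y (tendsto_tsum_of_dominated_convergence
    (hε.mul_right ((‖x‖ + ‖y‖) * Real.exp (∑' n, ε n)))
    (fun n => (hrec _).sub (hrec _)) (Eventually.of_forall fun k n => ?_))
  exact norm_cfRec_sub_le hε (h k) x y n

/-! ### The continued fraction for the product -/

theorem productCFNum_odd (a b q : ℂ) (m : ℕ) : productCFNum a b q (2 * m + 1) =
    (1 - a ^ 2 * q ^ (2 * m + 1)) * (1 - b ^ 2 * q ^ (2 * m + 1)) * q ^ (2 * m) :=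
  if_pos (odd_two_mul_add_one m)

theorem productCFNum_even (a b q : ℂ) (m : ℕ) : productCFNum a b q (2 * m + 2) =
    (a - b * q ^ (2 * m + 1)) * (b - a * q ^ (2 * m + 1)) * q ^ (2 * m + 2) :=
  if_neg (by rw [Nat.not_odd_iff_even]; exact ⟨m + 1, by ring⟩)

/-- The bound depends on a, b only through R, so it serves all the pairs (aq^(2k), bq^(2k)) at once.
-/
theorem productCF_bound {a b q : ℂ} (hq : ‖q‖ < 1) {R : ℝ} (ha : ‖a‖ ≤ R) (hb : ‖b‖ ≤ R) (n : ℕ) :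
    ‖productCFDen a b q (n + 1) - 1‖ + ‖productCFNum a b q (n + 1)‖ ≤
      (R * R + ((1 + R ^ 2) * (1 + R ^ 2) + (R + R) * (R + R))) * ‖q‖ ^ n := by
  have hR : 0 ≤ R := (norm_nonneg a).trans ha
  have hle : ∀ k, ‖q ^ k‖ ≤ 1 := fun k => by
    rw [norm_pow]; exact pow_le_one₀ (norm_nonneg q) hq.le
  have hmono : ∀ {k}, n ≤ k → ‖q ^ k‖ ≤ ‖q‖ ^ n := fun hk => by
    rw [norm_pow]; exact pow_le_pow_of_le_one (norm_nonneg q) hq.le hk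
  have hden : ‖productCFDen a b q (n + 1) - 1‖ ≤ R * R * ‖q‖ ^ n := by
    have : productCFDen a b q (n + 1) - 1 = -(a * b * q ^ (2 * (n + 1))) := by
      unfold productCFDen; ring
    rw [this, norm_neg, norm_mul, norm_mul]
    gcongr
    exact hmono (by lia)
  have hsq : ∀ {c : ℂ} (k), ‖c‖ ≤ R → ‖1 - c ^ 2 * q ^ k‖ ≤ 1 + R ^ 2 := fun k hc => by
    refine (norm_sub_le _ _).trans ?_
    rw [norm_one, norm_mul, norm_pow]
    exact add_le_add le_rfl ((mul_le_of_le_one_right (by positivity) (hle k)).trans (by gcongr))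
  have hsub : ∀ {c d : ℂ} (k), ‖c‖ ≤ R → ‖d‖ ≤ R → ‖c - d * q ^ k‖ ≤ R + R := fun k hc hd => by
    refine (norm_sub_le _ _).trans (add_le_add hc ?_)
    rw [norm_mul]
    exact (mul_le_of_le_one_right (norm_nonneg _) (hle k)).trans hd
  have hnum : ‖productCFNum a b q (n + 1)‖ ≤
      ((1 + R ^ 2) * (1 + R ^ 2) + (R + R) * (R + R)) * ‖q‖ ^ n := by
    unfold productCFNum
    split_ifs
    · rw [norm_mul, norm_mul]
      calc _ ≤ (1 + R ^ 2) * (1 + R ^ 2) * ‖q‖ ^ n := by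
            gcongr
            exacts [hsq _ ha, hsq _ hb, hmono (by lia)]
        _ ≤ _ := by gcongr; exact le_add_of_nonneg_right (by positivity)
    · rw [norm_mul, norm_mul]
      calc _ ≤ (R + R) * (R + R) * ‖q‖ ^ n := by
            gcongr
            exacts [hsub _ ha hb, hsub _ hb ha, hmono (by lia)]
        _ ≤ _ := by gcongr; exact le_add_of_nonneg_left (by positivity)
  rw [add_mul]
  exact add_le_add hden hnum

theorem summable_productCF_bound {q : ℂ} (hq : ‖q‖ < 1) (C : ℝ) :
    Summable fun n : ℕ => C * ‖q‖ ^ n :=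
  (summable_geometric_of_lt_one (norm_nonneg q) hq).mul_left C

/-- The limit of the solution of the recurrence belonging to the continued fraction. -/
noncomputable def productCFLim (a b q x y : ℂ) : ℂ := cfRecLim (productCFNum a b q) (productCFDen a b q) x y

theorem tendsto_cfRec_productCF (a b x y : ℂ) {q : ℂ} (hq : ‖q‖ < 1) :
    Tendsto (cfRec (productCFNum a b q) (productCFDen a b q) x y) atTop
      (𝓝 (productCFLim a b q x y)) :=
  tendsto_cfRec (summable_productCF_bound hq _)
    (productCF_bound hq (le_max_left ‖a‖ ‖b‖) (le_max_right ‖a‖ ‖b‖)) x y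

/-- A Bauer–Muir transformation relating the recurrences for `(a, b)` and `(a q, b q)`. -/
theorem cfRec_productCF_mul (a b q x y : ℂ) (m : ℕ) :
    cfRec (productCFNum (a * q) (b * q) q) (productCFDen (a * q) (b * q) q) y
        (productCFNum a b q 1 * x) (2 * m) =
      cfRec (productCFNum a b q) (productCFDen a b q) x y (2 * m + 1) ∧
    cfRec (productCFNum (a * q) (b * q) q) (productCFDen (a * q) (b * q) q) y
        (productCFNum a b q 1 * x) (2 * m + 1) =
      cfRec (productCFNum a b q) (productCFDen a b q) x y (2 * m + 2) -
        q ^ (2 * m) * (1 - a * b * q ^ 2) *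
          cfRec (productCFNum a b q) (productCFDen a b q) x y (2 * m + 1) := by
  induction m with
  | zero => simp [cfRec, productCFDen]
  | succ m ih =>
    have h₁ := cfRec_add_two (productCFNum a b q) (productCFDen a b q) x y (2 * m)
    have h₂ := cfRec_add_two (productCFNum a b q) (productCFDen a b q) x y (2 * m + 1)
    have h₃ := cfRec_add_two (productCFNum a b q) (productCFDen a b q) x y (2 * m + 2)
    have k₂ := cfRec_add_two (productCFNum (a * q) (b * q) q) (productCFDen (a * q) (b * q) q) y
      (productCFNum a b q 1 * x) (2 * m)
    have k₃ := cfRec_add_two (productCFNum (a * q) (b * q) q) (productCFDen (a * q) (b * q) q) y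
      (productCFNum a b q 1 * x) (2 * m + 1)
    have e : 2 * (m + 1) = 2 * m + 2 := by ring
    have hodd := productCFNum_odd a b q (m + 1)
    rw [e] at hodd ⊢
    simp only [productCFDen, productCFNum_odd, productCFNum_even, hodd, Nat.add_assoc,
      Nat.reduceAdd] at h₁ h₂ h₃ k₂ k₃ ih ⊢
    -- With primes for (aq,bq), β'₂ₘ₊₁ = β₂ₘ₊₂, so what remains is α'₂ₘ₊₁ - q^(2m)(1 - abq²)β₂ₘ₊₂ =
    -- α₂ₘ₊₂.
    rw [ih.1, ih.2] at k₂
    have hfst := k₂.trans (b := _) (c := cfRec (productCFNum a b q) (productCFDen a b q) x y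
      (2 * m + 3)) (by rw [h₂]; ring)
    refine ⟨hfst, ?_⟩
    rw [k₃, hfst, ih.2, h₃, h₂]
    ring

theorem productCFLim_mul (a b x y : ℂ) {q : ℂ} (hq : ‖q‖ < 1) :
    productCFLim (a * q) (b * q) q y (productCFNum a b q 1 * x) = productCFLim a b q x y := by
  have hev : Tendsto (fun m : ℕ => 2 * m) atTop atTop :=
    tendsto_atTop_mono (fun m => show m ≤ _ by lia) tendsto_id
  have hodd : Tendsto (fun m : ℕ => 2 * m + 1) atTop atTop :=
    tendsto_atTop_mono (fun m => show m ≤ _ by lia) tendsto_id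
  refine tendsto_nhds_unique ((tendsto_cfRec_productCF _ _ _ _ hq).comp hev) ?_
  refine ((tendsto_cfRec_productCF a b x y hq).comp hodd).congr fun m => ?_
  exact (cfRec_productCF_mul a b q x y m).1.symm

theorem productCFLim_zero_one (a b : ℂ) {q : ℂ} (hq : ‖q‖ < 1) :
    productCFLim a b q 0 1 = productCFLim (a * q) (b * q) q 1 0 := by
  simpa using (productCFLim_mul a b 0 1 hq).symm

/-- Two Bauer–Muir steps restore the initial pair (1, 0); linearity in the initial values extracts
α₁. -/
theorem productCFLim_one_zero (a b : ℂ) {q : ℂ} (hq : ‖q‖ < 1) :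
    productCFLim a b q 1 0 = (1 - a ^ 2 * q) * (1 - b ^ 2 * q) *
      productCFLim (a * q ^ 2) (b * q ^ 2) q 1 0 := by
  have hnum : productCFNum a b q 1 = (1 - a ^ 2 * q) * (1 - b ^ 2 * q) := by
    simpa using productCFNum_odd a b q 0
  have hmul : productCFLim (a * q) (b * q) q 0 (productCFNum a b q 1) =
      productCFNum a b q 1 * productCFLim (a * q) (b * q) q 0 1 := by
    refine tendsto_nhds_unique (tendsto_cfRec_productCF _ _ _ _ hq) ?_
    refine ((tendsto_cfRec_productCF (a * q) (b * q) 0 1 hq).const_mul _).congr fun n => ?_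
    simpa using (cfRec_smul _ _ (productCFNum a b q 1) 0 1 n).symm
  have h := productCFLim_mul a b 1 0 hq
  rw [mul_one, hmul, productCFLim_zero_one _ _ hq, hnum] at h
  rw [← h, pow_two q, mul_assoc a, mul_assoc b]

/-! ### Iteration of the functional equation -/

theorem productCFLim_one_zero_eq_prod (a b : ℂ) {q : ℂ} (hq : ‖q‖ < 1) (k : ℕ) :
    productCFLim a b q 1 0 =
      (∏ j ∈ Finset.range k, (1 - a ^ 2 * q * (q ^ 4) ^ j)) *
      (∏ j ∈ Finset.range k, (1 - b ^ 2 * q * (q ^ 4) ^ j)) *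
        productCFLim (a * q ^ (2 * k)) (b * q ^ (2 * k)) q 1 0 := by
  induction k with
  | zero => simp
  | succ k ih =>
    rw [ih, productCFLim_one_zero (a * q ^ (2 * k)) _ hq, Finset.prod_range_succ,
      Finset.prod_range_succ, show 2 * (k + 1) = 2 * k + 2 by ring]
    ring_nf

theorem productCFLim_eq_mul_productNum (a b : ℂ) {q : ℂ} (hq : ‖q‖ < 1) :
    productCFLim a b q 1 0 = productNum a b q * productCFLim 0 0 q 1 0 := by
  have hq4 : ‖q ^ 4‖ < 1 := by rw [norm_pow]; exact pow_lt_one₀ (norm_nonneg q) hq (by norm_num)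
  have hpow : Tendsto (fun k : ℕ => q ^ (2 * k)) atTop (𝓝 0) :=
    (tendsto_pow_atTop_nhds_zero_of_norm_lt_one hq).comp
      (tendsto_atTop_mono (fun k => show k ≤ _ by lia) tendsto_id)
  have hscale : ∀ c : ℂ, Tendsto (fun k : ℕ => c * q ^ (2 * k)) atTop (𝓝 0) := fun c => by
    simpa using hpow.const_mul c
  have hnorm : ∀ (c : ℂ) (k : ℕ), ‖c * q ^ (2 * k)‖ ≤ ‖c‖ := fun c k => by
    rw [norm_mul, norm_pow]
    exact mul_le_of_le_one_right (norm_nonneg _) (pow_le_one₀ (norm_nonneg q) hq.le)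
  have hlim : Tendsto (fun k => productCFLim (a * q ^ (2 * k)) (b * q ^ (2 * k)) q 1 0) atTop
      (𝓝 (productCFLim 0 0 q 1 0)) := by
    refine tendsto_cfRecLim (summable_productCF_bound hq _) (fun k => productCF_bound hq
      ((hnorm a k).trans (le_max_left ‖a‖ ‖b‖)) ((hnorm b k).trans (le_max_right ‖a‖ ‖b‖)))
      (fun n => ?_) (fun n => ?_) 1 0
    · unfold productCFNum
      split_ifs
      · exact ((tendsto_const_nhds.sub (((hscale a).pow 2).mul_const _)).mul
          (tendsto_const_nhds.sub (((hscale b).pow 2).mul_const _))).mul_const _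
      · exact (((hscale a).sub ((hscale b).mul_const _)).mul
          ((hscale b).sub ((hscale a).mul_const _))).mul_const _
    · exact tendsto_const_nhds.sub (((hscale a).mul (hscale b)).mul_const _)
  have hprod : ∀ c : ℂ, Tendsto (fun k => ∏ j ∈ Finset.range k, (1 - c * (q ^ 4) ^ j)) atTop
      (𝓝 (qPochInf c (q ^ 4))) := fun c =>
    (qPochInf_multipliable c hq4).hasProd.tendsto_prod_nat
  refine tendsto_nhds_unique tendsto_const_nhds
    ((((hprod (a ^ 2 * q)).mul (hprod (b ^ 2 * q))).mul hlim).congr fun k => ?_)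
  exact (productCFLim_one_zero_eq_prod a b hq k).symm

theorem productCFLim_eq_mul_productDen (a b : ℂ) {q : ℂ} (hq : ‖q‖ < 1) :
    productCFLim a b q 0 1 = productDen a b q * productCFLim 0 0 q 1 0 := by
  -- Replacing (a,b) by (aq,bq) turns a²q, b²q into a²q³, b²q³.
  rw [productCFLim_zero_one a b hq, productCFLim_eq_mul_productNum _ _ hq, productNum, productDen]
  ring_nf

/-! ### The constant at a = b = 0 -/

/-- Here β = 1 and the even-indexed numerators vanish, so values repeat in pairs and each
odd-indexed numerator q^(2m) with m ≥ 1 contributes a factor 1 + q^(2m). -/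
theorem cfRec_productCF_zero (q : ℂ) (m : ℕ) :
    cfRec (productCFNum 0 0 q) (productCFDen 0 0 q) 1 0 (2 * m + 2) =
      ∏ j ∈ Finset.range m, (1 + q ^ (2 * j + 2)) ∧
    cfRec (productCFNum 0 0 q) (productCFDen 0 0 q) 1 0 (2 * m + 3) =
      ∏ j ∈ Finset.range m, (1 + q ^ (2 * j + 2)) := by
  have hden : ∀ n, productCFDen 0 0 q n = 1 := fun n => by simp [productCFDen]
  have hnum_odd : ∀ m, productCFNum 0 0 q (2 * m + 1) = q ^ (2 * m) := fun m => by
    simp [productCFNum_odd]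
  have hnum_even : ∀ m, productCFNum 0 0 q (2 * m + 2) = 0 := fun m => by
    simp [productCFNum_even]
  have hodd : ∀ m, cfRec (productCFNum 0 0 q) (productCFDen 0 0 q) 1 0 (2 * m + 3) =
      cfRec (productCFNum 0 0 q) (productCFDen 0 0 q) 1 0 (2 * m + 2) := fun m => by
    rw [cfRec_add_two _ _ _ _ (2 * m + 1), hden, hnum_even]
    ring
  have heven : ∀ m, cfRec (productCFNum 0 0 q) (productCFDen 0 0 q) 1 0 (2 * m + 2) =
      ∏ j ∈ Finset.range m, (1 + q ^ (2 * j + 2)) := by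
    intro m
    induction m with
    | zero => simp [cfRec, productCFNum]
    | succ m ih =>
      have h := hnum_odd (m + 1)
      rw [show 2 * (m + 1) = 2 * m + 2 by ring] at h ⊢
      rw [cfRec_add_two _ _ _ _ (2 * m + 2), hden, h, hodd, ih, Finset.prod_range_succ]
      ring
  exact ⟨heven m, (hodd m).trans (heven m)⟩

theorem productCFLim_zero_ne_zero {q : ℂ} (hq : ‖q‖ < 1) : productCFLim 0 0 q 1 0 ≠ 0 := by
  have hsum : Summable fun j : ℕ => ‖q ^ (2 * j + 2)‖ := by
    refine (summable_geometric_of_lt_one (norm_nonneg q) hq).of_nonneg_of_le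
      (fun j => norm_nonneg _) fun j => ?_
    rw [norm_pow]
    exact pow_le_pow_of_le_one (norm_nonneg q) hq.le (by lia)
  have hne : ∀ j : ℕ, 1 + q ^ (2 * j + 2) ≠ 0 := fun j h0 => by
    have h1 : ‖q ^ (2 * j + 2)‖ = 1 := by
      rw [show q ^ (2 * j + 2) = -1 by linear_combination h0]
      simp
    rw [norm_pow] at h1
    exact (pow_lt_one₀ (norm_nonneg q) hq (by lia)).ne h1
  have hlim : productCFLim 0 0 q 1 0 = ∏' j : ℕ, (1 + q ^ (2 * j + 2)) := by
    have hshift : Tendsto (fun m : ℕ => 2 * m + 2) atTop atTop :=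
      tendsto_atTop_mono (fun m => show m ≤ _ by lia) tendsto_id
    refine tendsto_nhds_unique ((tendsto_cfRec_productCF 0 0 1 0 hq).comp hshift) ?_
    refine (multipliable_one_add_of_summable hsum).hasProd.tendsto_prod_nat.congr fun m => ?_
    exact (cfRec_productCF_zero q m).1.symm
  rw [hlim]
  exact tprod_one_add_ne_zero_of_summable hne hsum

theorem mainTheorem5 (a b q : ℂ) (hq : ‖q‖ < 1) (ha : a ≠ 0) (hz : ‖q * b / a‖ < 1)
    (hdef : productNum a b q ≠ 0 ∨ productDen a b q ≠ 0) :
    CFConvergesTo (productCFNum a b q) (productCFDen a b q)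
      (sphereDiv (productNum a b q) (productDen a b q)) := by
  have hc := productCFLim_zero_ne_zero hq
  have hnum := tendsto_cfRec_productCF a b 1 0 hq
  have hden := tendsto_cfRec_productCF a b 0 1 hq
  rw [productCFLim_eq_mul_productNum a b hq, mul_comm] at hnum
  rw [productCFLim_eq_mul_productDen a b hq, mul_comm] at hden
  rw [← sphereDiv_mul_left hc]
  exact cfConvergesTo_sphereDiv hnum hden
    (hdef.imp (mul_ne_zero hc) (mul_ne_zero hc))
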